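/- Let $K\subset S^3$ be a (tame) knot, $V(K)$ a tubular neighbourhood, $X=S^3\setminus V(K)$ and $\pi=\pi_1(X)$. Fix an isomorphism $\pi/\pi'\cong\mathbb Z=\langle t\rangle$ (equivalently, an orientation of a meridian $\mu$, whose image is $t$), and let $|\gamma|\in\mathbb Z$ denote the image of $\gamma\in\pi$. Let $\Lambda=\mathbb C[t,t^{-1}]$ and let $A=(\pi'/\pi'')\otimes\mathbb C\ (\cong H_1(X^\infty,\mathbb C))$ be the complex Alexander module, where $t$ acts by conjugation by an element $\mu$ with $|\mu|=1$. It is a finitely generated torsion $\Lambda$-module, and the Alexander polynomial $\Delta_K$ is a generator of its order ideal. Let $\alpha\in\mathbb C^*$ be a root of $\Delta_K$, let $\tau_\alpha\subseteq A$ be the $(t-\alpha)$-primary part, and fix a decomposition $$\tau_\alpha=\bigoplus_{i=1}^{k_\alpha}\tau_\alpha^i,\qquad \tau_\alpha^i\cong\Lambda/(t-\alpha)^{q_i},\qquad q_i\ge 1.$$ Let $\mathbb C_\alpha$ be $\mathbb C$ with $q(t)\in\Lambda$ acting as multiplication by $q(\alpha)$, so that $\gamma\in\pi$ acts as multiplication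 by $\alpha^{|\gamma|}$. Write $C^1,Z^1,B^1$ for the spaces of 1-cochains (all functions $\pi\to\mathbb C$), 1-cocycles ($U(\gamma_1\gamma_2)=U(\gamma_1)+\alpha^{|\gamma_1|}U(\gamma_2)$) and 1-coboundaries ($\gamma\mapsto\alpha^{|\gamma|}a-a$) of $\pi$ with values in $\mathbb C_\alpha$. Let $G_n$ be the group of invertible upper triangular complex $n\times n$ matrices, let $J_m$ be the $m\times m$ matrix with ones on the diagonal and on the superdiagonal and zeros elsewhere, and put $\phi_m(\gamma)=J_m^{|\gamma|}$. For $n\ge 2$ and $V=(v_1,\dots,v_{n-1})\in (C^1)^{n-1}$ let $$\rho_n^V(\gamma)=\begin{pmatrix}\alpha^{|\gamma|}&V(\gamma)\\0&\phi_{n-1}(\gamma)\end{pmatrix},$$ and let $$C_n=\{U\in Z^1(\pi,\mathbb C_\alpha)\mid \exists (v_2,\dots,v_{n-1})\in C^1(\pi,\mathbb C_\alpha)^{n-2}:\ \rho_n^{(U,v_2,\dots,v_{n-1})}\in\mathrm{Hom}(\pi,G_n)\}.$$ For $1\le i\le k_\alpha$ let $U_i\in Z^1(\pi,\mathbb C_\alpha)$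 be a cocycle whose restriction to $\pi'$ is induced by a $\Lambda$-homomorphism $A\to\mathbb C_\alpha$ that vanishes on $\tau_\alpha^j$ for all $j\ne i$ and restricts to a generator of $\mathrm{Hom}_\Lambda(\tau_\alpha^i,\mathbb C_\alpha)\cong\mathbb C$. Then such cocycles $U_1,\dots,U_{k_\alpha}$ exist and, for every $n\ge 2$: 1. $C_n$ is a linear subspace of $Z^1(\pi,\mathbb C_\alpha)$ that contains $B^1(\pi,\mathbb C_\alpha)$, and every homomorphism $\rho_n^V:\pi\to G_n$ is metabelian, i.e. trivial on $\pi''$. 2. $B^1(\pi,\mathbb C_\alpha)\subsetneq C_n$ if and only if $q_i\ge n-1$ for some $1\le i\le k_\alpha$. 3. For every choice of the $U_i$ as above, $C_n=B^1(\pi,\mathbb C_\alpha)\oplus\mathrm{Vect}\{U_i\mid q_i\ge n-1\}$. 4. $C_n$ is finite-dimensional and $\dim_{\mathbb C} C_n=1+\mathrm{card}\{1\le i\le k_\alpha\mid q_i\ge n-1\}$. -/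

import Mathlib

open scoped TensorProduct DirectSum LaurentPolynomial

noncomputable section

namespace KnotGroupRep

/-! ### Knots in the three-sphere and their exteriors -/

/-- The three-sphere. -/
abbrev S3 : Type := Metric.sphere (0 : EuclideanSpace ℝ (Fin 4)) 1

/-- An open tubular neighbourhood of a closed curve in the three-sphere: an open embedding of
`S¹ × ℝ²` whose restriction to `S¹ × {0}` is the given curve. -/
structure Tube (c : Circle → S3) where
  toFun : Circle × ℂ → S3
  isOpenEmbedding : Topology.IsOpenEmbedding toFun
  core : ∀ z : Circle, toFun (z, 0) = c z

/-- A (tame) knot: an embedded circle in the three-sphere that has a tubular neighbourhood. -/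
structure Knot where
  toFun : Circle → S3
  isEmbedding : Topology.IsEmbedding toFun
  tame : Nonempty (Tube toFun)

/-- The tubular neighbourhood `V(K)` of radius one inside a tube. -/
def Tube.solidTorus {c : Circle → S3} (T : Tube c) : Set S3 :=
  T.toFun '' {x | ‖x.2‖ < 1}

/-- The exterior `X = S³ ∖ V(K)`. -/
abbrev Tube.Exterior {c : Circle → S3} (T : Tube c) : Type :=
  {x : S3 // x ∉ T.solidTorus}

/-! ### The complex Alexander module

From here on `G` is a group with an identification `p` of its abelianization with `ℤ`
(written multiplicatively). -/

section Group

variable {G : Type} [Group G] (p : Abelianization G ≃* Multiplicative ℤ)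

/-- The projection `G → G/G' ≃ ℤ`. -/
def degHom : G →* Multiplicative ℤ :=
  p.toMonoidHom.comp Abelianization.of

/-- The integer `|γ|`. -/
def deg (γ : G) : ℤ :=
  (degHom p γ).toAdd

variable (G) in
/-- `ℂ ⊗ G'/G''`, without its module structure over the Laurent polynomials. -/
abbrev ComplexDerivedAb : Type :=
  ℂ ⊗[ℤ] Additive (Abelianization (commutator G))

/-- The endomorphism `z ⊗ y ↦ z ⊗ γ y γ⁻¹` of `ℂ ⊗ G'/G''`. -/
def conjAction : G →* Module.End ℂ (ComplexDerivedAb G) where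
  toFun γ := LinearMap.baseChange ℂ
    (MonoidHom.toAdditive (Abelianization.map
      (MulAut.conjNormal γ : MulAut (commutator G)).toMonoidHom)).toIntLinearMap
  map_one' := by
    ext x
    obtain ⟨x, rfl⟩ := QuotientGroup.mk_surjective x
    simp
    rfl
  map_mul' a b := by
    ext x
    obtain ⟨x, rfl⟩ := QuotientGroup.mk_surjective x
    simp
    rfl

lemma commutator_le_ker_conjAction : commutator G ≤ (conjAction (G := G)).ker := by
  intro γ hγ
  rw [MonoidHom.mem_ker]
  ext x
  obtain ⟨x, rfl⟩ := QuotientGroup.mk_surjective x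
  have h : Abelianization.of ((MulAut.conjNormal γ : MulAut (commutator G)) x)
      = Abelianization.of x := by
    have h' : (MulAut.conjNormal γ : MulAut (commutator G)) x
        = (⟨γ, hγ⟩ : commutator G) * x * (⟨γ, hγ⟩ : commutator G)⁻¹ := by
      ext
      simp
    rw [h', map_mul, map_mul, map_inv, mul_comm, inv_mul_cancel_left]
  change (1 : ℂ) ⊗ₜ[ℤ] Additive.ofMul
      (Abelianization.of ((MulAut.conjNormal γ : MulAut (commutator G)) x)) = _
  rw [h]
  rfl

/-- The action of `ℤ ≃ G/G'` on `ℂ ⊗ G'/G''` induced by conjugation in `G`. -/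
def deckAction : Multiplicative ℤ →* Module.End ℂ (ComplexDerivedAb G) :=
  (QuotientGroup.lift (commutator G) conjAction commutator_le_ker_conjAction).comp
    p.symm.toMonoidHom

/-- The complex Alexander module `ℂ ⊗ G'/G''`, on which `t` acts by conjugation by any element
`μ` with `|μ| = 1`. -/
def AlexanderModule (_p : Abelianization G ≃* Multiplicative ℤ) : Type :=
  ComplexDerivedAb G

instance : AddCommGroup (AlexanderModule p) :=
  inferInstanceAs (AddCommGroup (ComplexDerivedAb G))

instance : Module ℂ[T;T⁻¹] (AlexanderModule p) :=
  Module.compHom (ComplexDerivedAb G)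
    (AddMonoidAlgebra.lift ℂ (Module.End ℂ (ComplexDerivedAb G)) ℤ (deckAction p)).toRingHom

/-- The class `1 ⊗ [y]` in the Alexander module of an element `y` of `G'`. -/
def derivedClass (y : commutator G) : AlexanderModule p :=
  (1 : ℂ) ⊗ₜ[ℤ] Additive.ofMul (Abelianization.of y)

lemma T_smul_derivedClass (γ : G) (y : commutator G) :
    (LaurentPolynomial.T (deg p γ) : ℂ[T;T⁻¹]) • derivedClass p y
      = derivedClass p (MulAut.conjNormal γ y) := by
  have h : deckAction p (Multiplicative.ofAdd (deg p γ)) = conjAction γ := by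
    change QuotientGroup.lift (commutator G) conjAction commutator_le_ker_conjAction
      (p.symm (p (Abelianization.of γ))) = _
    rw [MulEquiv.symm_apply_apply]
    rfl
  change (AddMonoidAlgebra.lift ℂ (Module.End ℂ (ComplexDerivedAb G)) ℤ (deckAction p)
    (LaurentPolynomial.T (deg p γ))) _ = _
  rw [LaurentPolynomial.T, AddMonoidAlgebra.lift_single, one_smul, h]
  rfl

/-- `Δ` is an order of the finitely generated torsion module `M` over a principal ideal domain:
`M` is isomorphic to `⨁ R/(aᵢ)` with finitely many nonzero `aᵢ`, and `Δ` generates the order ideal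
`(∏ aᵢ)`. -/
def IsOrder {R M : Type} [CommRing R] [AddCommGroup M] [Module R M] (Δ : R) : Prop :=
  ∃ (m : ℕ) (a : Fin m → R), (∀ i, a i ≠ 0) ∧
    Nonempty (M ≃ₗ[R] ⨁ i : Fin m, R ⧸ Ideal.span {a i}) ∧
    Ideal.span {Δ} = Ideal.span {∏ i, a i}

/-- `Δ` is an Alexander polynomial: a generator of the order ideal of the Alexander module. -/
def IsAlexanderPolynomial (Δ : ℂ[T;T⁻¹]) : Prop :=
  IsOrder (M := AlexanderModule p) Δ

/-- The value `q(α)` of a Laurent polynomial at a nonzero complex number. -/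
def evalAt (α : ℂˣ) : ℂ[T;T⁻¹] →+* ℂ :=
  LaurentPolynomial.eval₂ (RingHom.id ℂ) α

/-- The Laurent polynomial `t - α`. -/
def tSub (α : ℂˣ) : ℂ[T;T⁻¹] :=
  LaurentPolynomial.T 1 - LaurentPolynomial.C (α : ℂ)

/-- The `α`-primary part `τ_α` of the Alexander module: the elements killed by a power of
`t - α`. -/
abbrev primaryPart (α : ℂˣ) : Submodule ℂ[T;T⁻¹] (AlexanderModule p) :=
  Submodule.torsion' ℂ[T;T⁻¹] (AlexanderModule p) (Submonoid.powers (tSub α))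

/-! ### Cochains with values in `ℂ_α` -/

/-- The `Λ`-module `ℂ_α`: complex numbers, with `q(t)` acting as multiplication by `q(α)`. -/
def LambdaC (_α : ℂˣ) : Type := ℂ

instance (α : ℂˣ) : AddCommGroup (LambdaC α) := inferInstanceAs (AddCommGroup ℂ)

instance (α : ℂˣ) : Module ℂ[T;T⁻¹] (LambdaC α) := Module.compHom ℂ (evalAt α)

/-- The representation `ℂ_α` of `G`: `γ` acts as multiplication by `α ^ |γ|`. -/
def repC (α : ℂˣ) : Representation ℂ G ℂ where
  toFun γ := LinearMap.lsmul ℂ ℂ ((α : ℂ) ^ deg p γ)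
  map_one' := by
    ext
    simp [deg]
  map_mul' a b := by
    ext
    simp [deg, zpow_add₀ α.ne_zero]

/-- The 1-cocycles `Z¹(G, ℂ_α)`. -/
def Z1 (α : ℂˣ) : Submodule ℂ (G → ℂ) :=
  groupCohomology.cocycles₁ (Rep.of (repC p α))

/-- The 1-coboundaries `B¹(G, ℂ_α)`. -/
def B1 (α : ℂˣ) : Submodule ℂ (G → ℂ) :=
  groupCohomology.coboundaries₁ (Rep.of (repC p α))

lemma mem_Z1_iff (α : ℂˣ) (U : G → ℂ) :
    U ∈ Z1 p α ↔ ∀ γ₁ γ₂ : G, (α : ℂ) ^ deg p γ₁ * U γ₂ - U (γ₁ * γ₂) + U γ₁ = 0 :=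
  groupCohomology.mem_cocycles₁_def (A := Rep.of (repC p α)) U

lemma mem_B1_iff (α : ℂˣ) (U : G → ℂ) :
    U ∈ B1 p α ↔ ∃ a : ℂ, ∀ γ : G, (α : ℂ) ^ deg p γ * a - a = U γ :=
  exists_congr fun _ => funext_iff

/-! ### The triangular representations -/

/-- The group `G_n` of invertible upper triangular complex matrices of size `n`. -/
def upperTriangularGroup (n : ℕ) : Subgroup (GL (Fin n) ℂ) where
  carrier := {g | (g : Matrix (Fin n) (Fin n) ℂ).BlockTriangular id}
  one_mem' := Matrix.blockTriangular_one
  mul_mem' ha hb := Matrix.BlockTriangular.mul ha hb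
  inv_mem' {g} hg := by
    have : Invertible (g : Matrix (Fin n) (Fin n) ℂ) := g.invertible
    simpa [Matrix.coe_units_inv] using Matrix.blockTriangular_inv_of_blockTriangular hg

/-- The matrix of size `m` with ones on the diagonal and just above it, zeros elsewhere. -/
def jordanBlock (m : ℕ) : Matrix (Fin m) (Fin m) ℂ :=
  Matrix.of fun i j => if (j : ℕ) = i ∨ (j : ℕ) = i + 1 then 1 else 0

/-- `φ_m(γ)`, where `φ_m` is the abelian homomorphism that sends elements `μ` with `|μ| = 1` to
the Jordan block. -/
def phi (m : ℕ) (γ : G) : Matrix (Fin m) (Fin m) ℂ :=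
  jordanBlock m ^ deg p γ

/-- The matrix `ρ^V(γ)`, of size `m + 1`, with first row `(α ^ |γ|, V(γ))`, first column
`(α ^ |γ|, 0)` and remaining block `φ_m(γ)`. -/
def rhoMatrix (α : ℂˣ) {m : ℕ} (V : Fin m → G → ℂ) (γ : G) :
    Matrix (Fin (m + 1)) (Fin (m + 1)) ℂ :=
  Matrix.of (Fin.cons (Fin.cons ((α : ℂ) ^ deg p γ) fun j => V j γ)
    fun i => Fin.cons 0 fun j => phi p m γ i j)

/-- The homomorphism `ρ : G → G_{m+1}` is the map `ρ^V`. -/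
def IsRho (α : ℂˣ) {m : ℕ} (V : Fin m → G → ℂ) (ρ : G →* upperTriangularGroup (m + 1)) : Prop :=
  ∀ γ : G, ((ρ γ : GL (Fin (m + 1)) ℂ) : Matrix (Fin (m + 1)) (Fin (m + 1)) ℂ)
    = rhoMatrix p α V γ

/-- The set `C_n`, for `n ≥ 2`: the 1-cocycles `U` for which there are `n - 2` cochains
`v_2, …, v_{n-1}` such that `ρ^{(U, v_2, …, v_{n-1})}` is a homomorphism to `G_n`. -/
def CSet (α : ℂˣ) (n : ℕ) : Set (G → ℂ) :=
  {U | U ∈ Z1 p α ∧ ∃ (v : Fin (n - 2) → G → ℂ) (ρ : G →* upperTriangularGroup (n - 2 + 1 + 1)),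
    IsRho p α (Fin.cons U v : Fin (n - 2 + 1) → G → ℂ) ρ}

/-- `U` is a cocycle `U_i`: it corresponds to a `Λ`-homomorphism from the Alexander module to `ℂ_α`
that is zero on the summands `Λ/(t - α)^{q_j}` of `τ_α` with `j ≠ i` and nonzero on the `i`-th one
(hence a generator of the one-dimensional space `Hom_Λ(Λ/(t - α)^{q_i}, ℂ_α)`). -/
def IsDualCocycle (α : ℂˣ) {k : ℕ} {q : Fin k → ℕ}
    (e : primaryPart p α ≃ₗ[ℂ[T;T⁻¹]] ⨁ i : Fin k, ℂ[T;T⁻¹] ⧸ Ideal.span {tSub α ^ q i})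
    (i : Fin k) (U : G → ℂ) : Prop :=
  U ∈ Z1 p α ∧ ∃ u : AlexanderModule p →ₗ[ℂ[T;T⁻¹]] LambdaC α,
    (∀ y : commutator G, u (derivedClass p y) = U y) ∧
    (∀ j, j ≠ i → ∀ x, u (e.symm (DirectSum.lof ℂ[T;T⁻¹] (Fin k)
      (fun i => ℂ[T;T⁻¹] ⧸ Ideal.span {tSub α ^ q i}) j x)) = 0) ∧
    ∃ x, u (e.symm (DirectSum.lof ℂ[T;T⁻¹] (Fin k)
      (fun i => ℂ[T;T⁻¹] ⧸ Ideal.span {tSub α ^ q i}) i x)) ≠ 0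

end Group

end KnotGroupRep

end

open scoped TensorProduct DirectSum LaurentPolynomial

noncomputable section

namespace KnotGroupRep

/-! ### Cocycles of `G` and homomorphisms on the Alexander module -/

section Cocycles

variable {G : Type} [Group G] (p : Abelianization G ≃* Multiplicative ℤ)

/-! Multiplying the row `V(γ)` on the right by `J ^ (-|γ|)` turns the condition that `ρ^V` be a
homomorphism into a cocycle identity (`isCocycle_rowCochain_iff`). The values lie in the module of
rows of length `n - 1`, where `t` acts as `α J⁻¹`. On this module `t - α` is a unit times the shift,
and the first coordinate is a `Λ`-homomorphism to `ℂ_α`.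

For any coefficient module, cocycles restrict to `Λ`-homomorphisms on the Alexander module `A`, and
every such homomorphism extends to a cocycle (`IsCocycle.exists_linearMap`, `exists_isCocycle`). A
root of `Δ` is never `1` (`root_ne_one`), so a cocycle with values in `ℂ_α` is determined up to a
coboundary by its restriction to `G'` (`mem_B1_of_forall_commutator`). Hence `U` lies in `C_n`
exactly when its restriction lifts through the first coordinate to a homomorphism from `A` to rows
(`coe_liftableCocycles`).

Such a lift can be studied on each cyclic summand `Λ/(t - α)^q`. Its generator may go to any row
killed by the `q`-th power of the shift. If `q ≥ n - 1`, every row qualifies; if `q < n - 1`, the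
first coordinate must vanish (`tSub_pow_smul_eq_zero`, `apply_zero_eq_zero_of_tSub_pow_smul`). So
exactly the `U_i` with `q_i ≥ n - 1` survive modulo coboundaries (`liftableCocycles_eq`). -/

lemma deg_mul (a b : G) : deg p (a * b) = deg p a + deg p b := by simp [deg]

lemma deg_one : deg p (1 : G) = 0 := by simp [deg]

lemma deg_inv (a : G) : deg p a⁻¹ = -deg p a := by simp [deg]

lemma deg_zpow (a : G) (n : ℤ) : deg p (a ^ n) = n * deg p a := by simp [deg]

lemma deg_eq_zero_iff (a : G) : deg p a = 0 ↔ a ∈ commutator G := by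
  rw [← Abelianization.ker_of G, MonoidHom.mem_ker, ← p.map_eq_one_iff]
  exact toAdd_eq_zero

lemma deg_coe (y : commutator G) : deg p (y : G) = 0 := (deg_eq_zero_iff p _).2 y.2

lemma exists_deg_eq_one : ∃ μ : G, deg p μ = 1 := by
  obtain ⟨μ, h⟩ := QuotientGroup.mk_surjective (p.symm (Multiplicative.ofAdd 1))
  refine ⟨μ, ?_⟩
  change (p (QuotientGroup.mk μ)).toAdd = 1
  rw [h]
  simp

lemma derivedClass_mul (y z : commutator G) :
    derivedClass p (y * z) = derivedClass p y + derivedClass p z := by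
  simp only [derivedClass, map_mul, ofMul_mul]
  exact TensorProduct.tmul_add _ _ _

lemma C_smul_derivedClass (c : ℂ) (y : commutator G) :
    (LaurentPolynomial.C c • derivedClass p y : AlexanderModule p)
      = (c ⊗ₜ[ℤ] Additive.ofMul (Abelianization.of y) : ComplexDerivedAb G) := by
  change (AddMonoidAlgebra.lift ℂ (Module.End ℂ (ComplexDerivedAb G)) ℤ (deckAction p)
    (LaurentPolynomial.C c)) ((1 : ℂ) ⊗ₜ[ℤ] Additive.ofMul (Abelianization.of y)) = _
  rw [← LaurentPolynomial.single_eq_C, AddMonoidAlgebra.lift_single, ofAdd_zero, map_one]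
  simp [TensorProduct.smul_tmul']

variable {p} in
/-- The Alexander module is spanned by the classes of the elements of `G'`. -/
lemma alexanderModule_induction {P : AlexanderModule p → Prop} (h0 : P 0)
    (hadd : ∀ x y, P x → P y → P (x + y))
    (hsmul : ∀ (c : ℂ) (y : commutator G), P (LaurentPolynomial.C c • derivedClass p y))
    (x : AlexanderModule p) : P x := by
  refine TensorProduct.induction_on (motive := P) x h0 (fun c y => ?_) hadd
  obtain ⟨z, hz⟩ := QuotientGroup.mk_surjective y.toMul
  have hy : y = Additive.ofMul (Abelianization.of z) := hz.symm
  rw [hy, ← C_smul_derivedClass]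
  exact hsmul c z

variable {M : Type} [AddCommGroup M] [Module ℂ[T;T⁻¹] M]

variable {p} in
lemma linearMap_ext_derivedClass {u v : AlexanderModule p →ₗ[ℂ[T;T⁻¹]] M}
    (h : ∀ y, u (derivedClass p y) = v (derivedClass p y)) : u = v := by
  ext x
  induction x using alexanderModule_induction with
  | h0 => simp
  | hadd x y hx hy => simp [hx, hy]
  | hsmul c y => simp [h]

/-- The 1-cocycles of `G` with values in a module over the Laurent polynomials, on which `γ` acts
as `t ^ |γ|`. -/
def IsCocycle (W : G → M) : Prop :=
  ∀ a b, W (a * b) = W a + (LaurentPolynomial.T (deg p a) : ℂ[T;T⁻¹]) • W b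

variable {p}

lemma IsCocycle.map_one {W : G → M} (hW : IsCocycle p W) : W 1 = 0 := by
  have := hW 1 1
  simpa [deg_one] using this

lemma IsCocycle.map_coe_mul {W : G → M} (hW : IsCocycle p W) (y : commutator G) (b : G) :
    W (y * b) = W y + W b := by
  rw [hW, deg_coe, LaurentPolynomial.T_zero, one_smul]

/-- Compare the two expansions of `W` on `(a y a⁻¹) a = a y`. This identity makes the restriction of
a cocycle `Λ`-linear. -/
lemma IsCocycle.map_conj {W : G → M} (hW : IsCocycle p W) (a : G) (y : commutator G) :
    W (MulAut.conjNormal a y : commutator G)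
      = (LaurentPolynomial.T (deg p a) : ℂ[T;T⁻¹]) • W y := by
  have h : ((MulAut.conjNormal a y : commutator G) : G) * a = a * y := by simp
  have h1 := hW.map_coe_mul (MulAut.conjNormal a y) a
  rw [h, hW, add_comm] at h1
  exact (add_right_cancel h1).symm

/-- A cocycle restricts to a homomorphism `G'/G'' → M`. -/
def IsCocycle.restrict {W : G → M} (hW : IsCocycle p W) :
    Additive (Abelianization (commutator G)) →+ M :=
  MonoidHom.toAdditiveLeft (Abelianization.lift
    { toFun := fun y : commutator G => Multiplicative.ofAdd (W y)
      map_one' := by simp [hW.map_one]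
      map_mul' := fun y z => by
        rw [← ofAdd_add, ← hW.map_coe_mul, Subgroup.coe_mul] })

/-- A cocycle restricts to a homomorphism on the Alexander module. -/
lemma IsCocycle.exists_linearMap {W : G → M} (hW : IsCocycle p W) :
    ∃ w : AlexanderModule p →ₗ[ℂ[T;T⁻¹]] M, ∀ y, w (derivedClass p y) = W y := by
  let f : ℂ →+ Additive (Abelianization (commutator G)) →+ M :=
    AddMonoidHom.mk' (fun c => (DistribSMul.toAddMonoidHom M
      (LaurentPolynomial.C c : ℂ[T;T⁻¹])).comp hW.restrict) (fun a b => by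
        ext y
        simp [add_smul])
  let F : AlexanderModule p →+ M := TensorProduct.liftAddHom (R := ℤ) f (fun r m n => by
    rw [map_zsmul, map_zsmul, AddMonoidHom.smul_apply])
  have hF : ∀ (c : ℂ) (y : commutator G),
      F (LaurentPolynomial.C c • derivedClass p y) = (LaurentPolynomial.C c : ℂ[T;T⁻¹]) • W y := by
    intro c y
    rw [C_smul_derivedClass]
    exact TensorProduct.liftAddHom_tmul ..
  obtain ⟨μ, hμ⟩ := exists_deg_eq_one p
  -- `t ^ n` acts as conjugation by `μ ^ n`, so `map_conj` gives equivariance.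
  have hT : ∀ (n : ℤ) (x : AlexanderModule p),
      F ((LaurentPolynomial.T n : ℂ[T;T⁻¹]) • x) = (LaurentPolynomial.T n : ℂ[T;T⁻¹]) • F x := by
    intro n x
    induction x using alexanderModule_induction with
    | h0 => simp
    | hadd x y hx hy => simp [hx, hy]
    | hsmul c y =>
      have hn : n = deg p (μ ^ n) := by rw [deg_zpow, hμ, mul_one]
      rw [smul_comm, hF]
      conv_lhs => rw [hn]
      rw [T_smul_derivedClass, hF, hW.map_conj, ← hn, smul_comm]
  have hC : ∀ (a : ℂ) (x : AlexanderModule p),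
      F (LaurentPolynomial.C a • x) = (LaurentPolynomial.C a : ℂ[T;T⁻¹]) • F x := by
    intro a x
    induction x using alexanderModule_induction with
    | h0 => simp
    | hadd x y hx hy => simp [hx, hy]
    | hsmul c y => rw [smul_smul, ← map_mul, hF, hF, map_mul, mul_smul]
  refine ⟨{ F with
    map_smul' := fun r x => ?_ }, fun y => ?_⟩
  · change F (r • x) = r • F x
    induction r using LaurentPolynomial.induction_on' with
    | add r s hr hs => simp [add_smul, hr, hs]
    | C_mul_T n a => rw [mul_smul, hC, hT, mul_smul]
  · have := hF 1 y
    simpa using this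

variable (p) in
/-- The element `γ μ ^ (-|γ|)` of `G'`. -/
def derivedPart {μ : G} (hμ : deg p μ = 1) (a : G) : commutator G :=
  ⟨a * μ ^ (-deg p a), (deg_eq_zero_iff p _).1 (by rw [deg_mul, deg_zpow, hμ]; ring)⟩

/-- A homomorphism on the Alexander module extends to a cocycle. -/
lemma exists_isCocycle (w : AlexanderModule p →ₗ[ℂ[T;T⁻¹]] M) :
    ∃ W : G → M, IsCocycle p W ∧ ∀ y : commutator G, W y = w (derivedClass p y) := by
  obtain ⟨μ, hμ⟩ := exists_deg_eq_one p
  refine ⟨fun a => w (derivedClass p (derivedPart p hμ a)), fun a b => ?_, fun y => ?_⟩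
  -- The map `γ ↦ γ μ ^ (-|γ|)` is a crossed homomorphism to `G'` for conjugation by powers of `μ`.
  · have h : derivedPart p hμ (a * b)
        = derivedPart p hμ a * MulAut.conjNormal (μ ^ deg p a) (derivedPart p hμ b) := by
      ext
      simp only [derivedPart, deg_mul, Subgroup.coe_mul, MulAut.conjNormal_apply]
      group
    have h' : deg p a = deg p (μ ^ deg p a) := by rw [deg_zpow, hμ, mul_one]
    simp only
    rw [h, derivedClass_mul, map_add, ← T_smul_derivedClass, ← h', map_smul]
  · have : derivedPart p hμ y = y := by
      ext
      simp [derivedPart, deg_coe]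
    simp only [this]

/-! ### Values in `ℂ_α` -/

variable {α : ℂˣ}

lemma lambdaC_smul (f : ℂ[T;T⁻¹]) (x : LambdaC α) :
    f • x = @HMul.hMul ℂ ℂ ℂ _ (evalAt α f) x := rfl

lemma lambdaC_smul_eq_zero {f : ℂ[T;T⁻¹]} (hf : evalAt α f = 0) (x : LambdaC α) : f • x = 0 := by
  rw [lambdaC_smul, hf]
  exact zero_mul (M₀ := ℂ) x

lemma lambdaC_smul_eq_self {f : ℂ[T;T⁻¹]} (hf : evalAt α f = 1) (x : LambdaC α) : f • x = x := by
  rw [lambdaC_smul, hf]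
  exact one_mul (M := ℂ) x

lemma evalAt_T (n : ℤ) : evalAt α (LaurentPolynomial.T n) = (α : ℂ) ^ n := by
  simp [evalAt]

lemma evalAt_C (c : ℂ) : evalAt α (LaurentPolynomial.C c) = c := by
  simp [evalAt]

lemma evalAt_tSub : evalAt α (tSub α) = 0 := by
  simp [tSub, evalAt_T, evalAt_C]

lemma mem_Z1_iff_isCocycle {U : G → ℂ} : U ∈ Z1 p α ↔ IsCocycle p (M := LambdaC α) U := by
  rw [mem_Z1_iff]
  refine forall₂_congr fun a b => ?_
  have h : (U (a * b) = U a + evalAt α (LaurentPolynomial.T (deg p a)) * U b)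
      ↔ (α : ℂ) ^ deg p a * U b - U (a * b) + U a = 0 := by
    rw [evalAt_T]
    constructor <;> intro h <;> linear_combination -h
  exact h.symm

/-- A cocycle that vanishes on `G'` is a coboundary. -/
lemma mem_B1_of_forall_commutator (hα : (α : ℂ) ≠ 1) {U : G → ℂ} (hU : U ∈ Z1 p α)
    (h : ∀ y : commutator G, U y = 0) : U ∈ B1 p α := by
  obtain ⟨μ, hμ⟩ := exists_deg_eq_one p
  have hα' : (α : ℂ) - 1 ≠ 0 := sub_ne_zero.2 hα
  refine (mem_B1_iff p α U).2 ⟨U μ / (α - 1), fun γ => ?_⟩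
  have hZ := (mem_Z1_iff p α U).1 hU
  -- Since `μ γ` and `γ μ` differ by an element of `G'`, `U` agrees on them. Equating the two
  -- expansions gives `(α - 1) U γ = (α ^ |γ| - 1) U μ`.
  let y : commutator G := ⟨μ * γ * μ⁻¹ * γ⁻¹, (deg_eq_zero_iff p _).1 (by
    simp only [deg_mul, deg_inv]; ring)⟩
  have h1 := hZ y (γ * μ)
  have h2 : (y : G) * (γ * μ) = μ * γ := by simp only [y]; group
  rw [h2, deg_coe, h y, zpow_zero] at h1
  have h3 := hZ μ γ
  have h4 := hZ γ μ
  rw [hμ, zpow_one] at h3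
  field_simp
  linear_combination h4 - h3 + h1

lemma eq_zero_of_mem_B1 {U : G → ℂ} (hU : U ∈ B1 p α) (y : commutator G) : U y = 0 := by
  obtain ⟨a, ha⟩ := (mem_B1_iff p α U).1 hU
  rw [← ha, deg_coe]
  simp

lemma B1_le_Z1 : B1 p α ≤ Z1 p α := by
  intro U hU
  obtain ⟨a, ha⟩ := (mem_B1_iff p α U).1 hU
  rw [mem_Z1_iff]
  intro x y
  rw [← ha, ← ha, ← ha, deg_mul, zpow_add₀ α.ne_zero]
  ring

lemma B1_eq_span : B1 p α = Submodule.span ℂ {fun γ => (α : ℂ) ^ deg p γ - 1} := by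
  ext U
  rw [mem_B1_iff, Submodule.mem_span_singleton]
  refine exists_congr fun a => ?_
  rw [funext_iff]
  refine forall_congr' fun γ => ?_
  simp [mul_sub, mul_comm]

instance : Module.Finite ℂ (B1 p α) := by
  rw [B1_eq_span]
  infer_instance

lemma finrank_B1 (hα : (α : ℂ) ≠ 1) : Module.finrank ℂ (B1 p α) = 1 := by
  rw [B1_eq_span]
  refine finrank_span_singleton fun h => hα ?_
  obtain ⟨μ, hμ⟩ := exists_deg_eq_one p
  have := congrFun h μ
  simpa [hμ, sub_eq_zero] using this

/-- The Alexander module has no quotient on which `t` acts trivially. -/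
lemma linearMap_eq_zero_of_eq_one (hα : (α : ℂ) = 1)
    (u : AlexanderModule p →ₗ[ℂ[T;T⁻¹]] LambdaC α) : u = 0 := by
  obtain ⟨W, hW, hu⟩ := exists_isCocycle u
  refine linearMap_ext_derivedClass fun y => ?_
  rw [← hu]
  -- For `α = 1` the cocycle extending `u` is a homomorphism to an abelian group, hence trivial on
  -- `G'`.
  let φ : G →* Multiplicative (LambdaC α) :=
    { toFun := fun γ => Multiplicative.ofAdd (W γ)
      map_one' := by simp [hW.map_one]
      map_mul' := fun a b => by
        have h : (LaurentPolynomial.T (deg p a) : ℂ[T;T⁻¹]) • W b = W b := by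
          exact lambdaC_smul_eq_self (by rw [evalAt_T, hα, one_zpow]) _
        rw [← ofAdd_add, hW, h] }
  exact Abelianization.commutator_subset_ker φ y.2

/-- Evaluation at a root `α` of `a`, as a homomorphism `Λ/(a) → ℂ_α`. -/
def quotientEval {a : ℂ[T;T⁻¹]} (ha : evalAt α a = 0) :
    (ℂ[T;T⁻¹] ⧸ Ideal.span {a}) →ₗ[ℂ[T;T⁻¹]] LambdaC α :=
  Submodule.liftQSpanSingleton a
    (LinearMap.toSpanSingleton ℂ[T;T⁻¹] (LambdaC α) (1 : ℂ)) (lambdaC_smul_eq_zero ha _)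

lemma quotientEval_mk_one {a : ℂ[T;T⁻¹]} (ha : evalAt α a = 0) :
    quotientEval ha (Submodule.Quotient.mk 1) ≠ 0 := by
  have h : quotientEval ha (Submodule.Quotient.mk 1) = (1 : ℂ) :=
    lambdaC_smul_eq_self (map_one _) _
  rw [h]
  exact one_ne_zero (α := ℂ)

/-- A root of the Alexander polynomial is different from `1`. -/
lemma root_ne_one {Δ : ℂ[T;T⁻¹]} (hΔ : IsAlexanderPolynomial p Δ) (hroot : evalAt α Δ = 0) :
    (α : ℂ) ≠ 1 := by
  intro hα
  obtain ⟨m, a, -, ⟨f⟩, ha⟩ := hΔ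
  have hdvd : Δ ∣ ∏ i, a i := by
    rw [← Ideal.mem_span_singleton, ha]
    exact Ideal.mem_span_singleton_self _
  obtain ⟨c, hc⟩ := hdvd
  have h : evalAt α (∏ i, a i) = 0 := by rw [hc, map_mul, hroot, zero_mul]
  rw [map_prod, Finset.prod_eq_zero_iff] at h
  obtain ⟨i, -, hi⟩ := h
  -- Since `α` is a root of some `a i`, evaluation on that summand is a nonzero homomorphism to
  -- `ℂ_α`, which cannot exist for `α = 1`.
  let u : AlexanderModule p →ₗ[ℂ[T;T⁻¹]] LambdaC α :=
    quotientEval hi ∘ₗ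
      DirectSum.component _ _ (fun i => ℂ[T;T⁻¹] ⧸ Ideal.span {a i}) i ∘ₗ f.toLinearMap
  have hu := LinearMap.congr_fun (linearMap_eq_zero_of_eq_one hα u)
    (f.symm (DirectSum.lof ℂ[T;T⁻¹] _ (fun i => ℂ[T;T⁻¹] ⧸ Ideal.span {a i}) i
      (Submodule.Quotient.mk 1)))
  rw [LinearMap.comp_apply, LinearMap.comp_apply, LinearEquiv.coe_coe,
    LinearEquiv.apply_symm_apply, DirectSum.component.lof_self] at hu
  exact quotientEval_mk_one hi hu

/-! ### The primary part -/

/-- The product of the `a i` kills the module. Up to a power of `t`, which is a unit, it is a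
polynomial, from which the full power of `X - α` is split off. -/
lemma exists_tSub_pow_mul_smul_eq_zero {Δ : ℂ[T;T⁻¹]} (hΔ : IsAlexanderPolynomial p Δ)
    (α : ℂˣ) : ∃ (N : ℕ) (b : ℂ[T;T⁻¹]), (∀ x : AlexanderModule p, (tSub α ^ N * b) • x = 0) ∧
      ∀ r, IsCoprime (tSub α ^ r) b := by
  obtain ⟨m, a, ha0, ⟨f⟩, -⟩ := hΔ
  have hprod : ∏ i, a i ≠ 0 := Finset.prod_ne_zero_iff.2 fun i _ => ha0 i
  obtain ⟨d, P, hP⟩ := LaurentPolynomial.exists_T_pow (∏ i, a i)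
  have hP0 : P ≠ 0 := by
    rw [← Polynomial.toLaurent_ne_zero, hP]
    exact mul_ne_zero hprod (LaurentPolynomial.isUnit_T _).ne_zero
  obtain ⟨Q, hQ, hdvd⟩ := P.exists_eq_pow_rootMultiplicity_mul_and_not_dvd hP0 α
  have ht : (Polynomial.X - Polynomial.C (α : ℂ)).toLaurent = tSub α := by
    simp [tSub]
  refine ⟨P.rootMultiplicity (α : ℂ), Q.toLaurent, fun x => ?_, fun r => ?_⟩
  · rw [← ht, ← map_pow, ← map_mul, ← hQ, hP, mul_comm, mul_smul]
    have : (∏ i, a i) • x = 0 := by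
      apply f.injective
      rw [map_smul, map_zero]
      refine DFinsupp.ext fun i => ?_
      rw [DirectSum.smul_apply]
      obtain ⟨z, hz⟩ := Submodule.Quotient.mk_surjective _ (f x i)
      rw [← hz, ← Submodule.Quotient.mk_smul]
      refine (Submodule.Quotient.mk_eq_zero _).2 (Ideal.mul_mem_right _ _ ?_)
      exact Ideal.mem_span_singleton.2 (Finset.dvd_prod_of_mem a (Finset.mem_univ i))
    rw [this, smul_zero]
  · rw [← ht, ← map_pow]
    exact ((((Polynomial.irreducible_X_sub_C (α : ℂ)).coprime_iff_not_dvd).2 hdvd).pow_left).map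
      Polynomial.toLaurent

/-- The primary part is a direct summand. -/
lemma exists_projection {Δ : ℂ[T;T⁻¹]} (hΔ : IsAlexanderPolynomial p Δ) (α : ℂˣ) :
    ∃ P : AlexanderModule p →ₗ[ℂ[T;T⁻¹]] primaryPart p α, ∀ x : primaryPart p α, P x = x := by
  obtain ⟨N, b, hb, hcop⟩ := exists_tSub_pow_mul_smul_eq_zero hΔ α
  obtain ⟨x, y, hxy⟩ := hcop N
  -- By the Bézout relation, `y * b` acts as the identity on whatever `(t - α) ^ N` kills, and its
  -- image is killed by that power.
  refine ⟨(LinearMap.lsmul ℂ[T;T⁻¹] (AlexanderModule p) (y * b)).codRestrict _ fun z => ?_,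
    fun z => ?_⟩
  · refine ⟨⟨tSub α ^ N, N, rfl⟩, ?_⟩
    change tSub α ^ N • (y * b) • z = 0
    rw [smul_smul, mul_left_comm, mul_smul, hb, smul_zero]
  · obtain ⟨z, ⟨_, M, rfl⟩, hz⟩ := z
    change tSub α ^ M • z = 0 at hz
    ext
    change (y * b) • z = z
    -- The exponent `M` may exceed `N`; coprimality of `(t - α) ^ M` and `b` shows that the exponent
    -- `N` already suffices.
    obtain ⟨s, t, hst⟩ := hcop M
    have h1 : tSub α ^ N • z = 0 := by
      have h2 : (s * tSub α ^ M + t * b) • tSub α ^ N • z = tSub α ^ N • z := by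
        rw [hst, one_smul]
      rw [← h2, smul_smul, show (s * tSub α ^ M + t * b) * tSub α ^ N
        = (s * tSub α ^ N) * tSub α ^ M + t * (tSub α ^ N * b) by ring, add_smul,
        mul_smul _ _ z, mul_smul t, hz, hb, smul_zero, smul_zero, add_zero]
    have h3 := congrArg (· • z) hxy
    simpa [add_smul, mul_smul x, h1] using h3

/-- Homomorphisms from the Alexander module to `ℂ_α` are determined on the primary part. -/
lemma linearMap_ext_primaryPart {Δ : ℂ[T;T⁻¹]} (hΔ : IsAlexanderPolynomial p Δ)
    {u v : AlexanderModule p →ₗ[ℂ[T;T⁻¹]] LambdaC α} (h : ∀ x : primaryPart p α, u x = v x) :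
    u = v := by
  obtain ⟨N, b, hb, hcop⟩ := exists_tSub_pow_mul_smul_eq_zero hΔ α
  -- The exponent `N + 1` is positive even if `N = 0`, so this power acts as zero on `ℂ_α`.
  obtain ⟨x, y, hxy⟩ := hcop (N + 1)
  have key : ∀ (w : AlexanderModule p →ₗ[ℂ[T;T⁻¹]] LambdaC α) z, w ((y * b) • z) = w z := by
    intro w z
    have : w ((x * tSub α ^ (N + 1)) • z) = 0 := by
      rw [map_smul]
      exact lambdaC_smul_eq_zero (by
        rw [map_mul, map_pow, evalAt_tSub, zero_pow N.succ_ne_zero, mul_zero]) _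
    have h1 := congrArg (fun r => w (r • z)) hxy
    simp only [add_smul, map_add, this, zero_add, one_smul] at h1
    exact h1
  ext z
  rw [← key u, ← key v]
  refine h ⟨(y * b) • z, ⟨tSub α ^ N, N, rfl⟩, ?_⟩
  change tSub α ^ N • (y * b) • z = 0
  rw [smul_smul, mul_left_comm, mul_smul, hb, smul_zero]

end Cocycles

section Jordan

open Matrix

/-! ### The Jordan block -/

lemma blockTriangular_jordanBlock (m : ℕ) : (jordanBlock m).BlockTriangular id := by
  intro i j h
  have h' : (j : ℕ) < i := h
  simp only [jordanBlock, of_apply]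
  rw [if_neg (by omega)]

lemma det_jordanBlock (m : ℕ) : (jordanBlock m).det = 1 := by
  rw [det_of_isUpperTriangular (blockTriangular_jordanBlock m)]
  simp [jordanBlock]

lemma isUnit_det_jordanBlock (m : ℕ) : IsUnit (jordanBlock m).det := by
  rw [det_jordanBlock]
  exact isUnit_one

/-- Negative powers are covered because the invertible upper triangular matrices form a group. -/
lemma blockTriangular_jordanBlock_zpow (m : ℕ) (n : ℤ) :
    (jordanBlock m ^ n).BlockTriangular id := by
  let g : GL (Fin m) ℂ := GeneralLinearGroup.mk'' (jordanBlock m) (isUnit_det_jordanBlock m)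
  have hg : g ∈ upperTriangularGroup m := blockTriangular_jordanBlock m
  have h : ((g ^ n : GL (Fin m) ℂ) : Matrix (Fin m) (Fin m) ℂ).BlockTriangular id :=
    zpow_mem hg n
  rwa [coe_units_zpow] at h

lemma jordanBlock_zpow_add (m : ℕ) (a b : ℤ) :
    jordanBlock m ^ (a + b) = jordanBlock m ^ a * jordanBlock m ^ b :=
  zpow_add (isUnit_det_jordanBlock m) a b

/-- The nilpotent part of the Jordan block. -/
def shiftMatrix (m : ℕ) : Matrix (Fin m) (Fin m) ℂ :=
  of fun i j => if (j : ℕ) = i + 1 then 1 else 0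

lemma jordanBlock_eq (m : ℕ) : jordanBlock m = 1 + shiftMatrix m := by
  ext i j
  simp only [jordanBlock, shiftMatrix, Matrix.add_apply, of_apply, one_apply, Fin.ext_iff]
  split_ifs <;> first | omega | simp

lemma vecMul_shiftMatrix_eq_zero {m k : ℕ} {x : Fin m → ℂ} (hx : ∀ i : Fin m, (i : ℕ) < k → x i = 0)
    (j : Fin m) (hj : (j : ℕ) < k + 1) : (x ᵥ* shiftMatrix m) j = 0 := by
  refine Finset.sum_eq_zero (s := Finset.univ) (f := fun i => x i * shiftMatrix m i j)
    fun i _ => ?_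
  simp only [shiftMatrix, of_apply]
  split_ifs with h
  · rw [hx i (by omega), zero_mul]
  · rw [mul_zero]

lemma vecMul_shiftMatrix_succ {m : ℕ} (x : Fin m → ℂ) (i j : Fin m) (h : (j : ℕ) = i + 1) :
    (x ᵥ* shiftMatrix m) j = x i := by
  refine (Finset.sum_eq_single (s := Finset.univ) (f := fun l => x l * shiftMatrix m l j) i
    (fun l _ hl => ?_) (by simp)).trans ?_
  · have : (j : ℕ) ≠ l + 1 := fun h' => hl (Fin.ext (by omega))
    simp [shiftMatrix, this]
  · simp [shiftMatrix, h]

lemma vecMul_jordanBlock_zpow_zero {m : ℕ} (n : ℤ) (x : Fin (m + 1) → ℂ) :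
    (x ᵥ* jordanBlock (m + 1) ^ n) 0 = x 0 := by
  have h1 : ∀ y : Fin (m + 1) → ℂ, (y ᵥ* jordanBlock (m + 1)) 0 = y 0 := by
    intro y
    rw [jordanBlock_eq, vecMul_add, vecMul_one, Pi.add_apply,
      vecMul_shiftMatrix_eq_zero (k := 0) (by simp) 0 (by simp), add_zero]
  induction n using Int.induction_on with
  | zero => simp
  | succ n ih => rw [zpow_add_one (isUnit_det_jordanBlock _), ← vecMul_vecMul, h1, ih]
  | pred n ih =>
    rw [← ih, ← h1 (x ᵥ* jordanBlock (m + 1) ^ (-(n : ℤ) - 1)), vecMul_vecMul,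
      ← zpow_add_one (isUnit_det_jordanBlock _), sub_add_cancel]

/-! ### The module of row vectors -/

/-- The module of row vectors of size `m`, on which `t` acts by multiplication by
`α J⁻¹` from the right. -/
def JordanModule (_α : ℂˣ) (m : ℕ) : Type := Fin m → ℂ

instance (α : ℂˣ) (m : ℕ) : AddCommGroup (JordanModule α m) :=
  inferInstanceAs (AddCommGroup (Fin m → ℂ))

/-- The action of `ℤ` on row vectors in which `n` acts as `α ^ n J⁻ⁿ`. -/
def jordanAction (α : ℂˣ) (m : ℕ) : Multiplicative ℤ →* Module.End ℂ (Fin m → ℂ) where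
  toFun n := (α : ℂ) ^ n.toAdd • vecMulLinear (jordanBlock m ^ (-n.toAdd))
  map_one' := by
    ext
    simp
  map_mul' a b := by
    refine LinearMap.ext fun x => ?_
    simp only [toAdd_mul, LinearMap.smul_apply, vecMulLinear_apply, Module.End.mul_apply,
      smul_vecMul, vecMul_vecMul, smul_smul]
    rw [neg_add_rev, jordanBlock_zpow_add, zpow_add₀ α.ne_zero]

instance (α : ℂˣ) (m : ℕ) : Module ℂ[T;T⁻¹] (JordanModule α m) :=
  Module.compHom (Fin m → ℂ)
    (AddMonoidAlgebra.lift ℂ (Module.End ℂ (Fin m → ℂ)) ℤ (jordanAction α m)).toRingHom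

variable {α : ℂˣ} {m : ℕ}

lemma jordanModule_T_smul (n : ℤ) (x : JordanModule α m) :
    (LaurentPolynomial.T n : ℂ[T;T⁻¹]) • x
      = ((α : ℂ) ^ n • (x ᵥ* jordanBlock m ^ (-n)) : Fin m → ℂ) := by
  change (AddMonoidAlgebra.lift ℂ (Module.End ℂ (Fin m → ℂ)) ℤ (jordanAction α m)
    (LaurentPolynomial.T n)) x = _
  rw [LaurentPolynomial.T, AddMonoidAlgebra.lift_single, one_smul]
  rfl

lemma jordanModule_C_smul (c : ℂ) (x : JordanModule α m) :
    (LaurentPolynomial.C c : ℂ[T;T⁻¹]) • x = @HSMul.hSMul ℂ (Fin m → ℂ) _ _ c x := by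
  change (AddMonoidAlgebra.lift ℂ (Module.End ℂ (Fin m → ℂ)) ℤ (jordanAction α m)
    (LaurentPolynomial.C c)) x = _
  rw [← LaurentPolynomial.single_eq_C, AddMonoidAlgebra.lift_single, ofAdd_zero, map_one]
  rfl

/-- The Laurent polynomial `α t⁻¹ - 1`, which acts on row vectors as the shift. -/
def shiftPoly (α : ℂˣ) : ℂ[T;T⁻¹] :=
  LaurentPolynomial.C (α : ℂ) * LaurentPolynomial.T (-1) - 1

lemma shiftPoly_smul (x : JordanModule α m) :
    shiftPoly α • x = (x ᵥ* shiftMatrix m : Fin m → ℂ) := by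
  have h : ∀ y : Fin m → ℂ, y ᵥ* jordanBlock m - y = y ᵥ* shiftMatrix m := by
    intro y
    rw [jordanBlock_eq, vecMul_add, vecMul_one, add_sub_cancel_left]
  rw [shiftPoly, sub_smul, mul_smul, one_smul, jordanModule_C_smul, jordanModule_T_smul, smul_smul,
    neg_neg, zpow_one, _root_.zpow_neg_one, mul_inv_cancel₀ α.ne_zero, one_smul]
  exact h x

/-- As `t` is a unit, powers of `t - α` and of the shift kill the same rows. -/
lemma tSub_eq_mul_shiftPoly : tSub α = -LaurentPolynomial.T 1 * shiftPoly α := by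
  have h : (LaurentPolynomial.T 1 * LaurentPolynomial.T (-1) : ℂ[T;T⁻¹]) = 1 := by
    rw [← LaurentPolynomial.T_add, add_neg_cancel, LaurentPolynomial.T_zero]
  rw [tSub, shiftPoly]
  linear_combination LaurentPolynomial.C (α : ℂ) * h

lemma shiftPoly_pow_smul_apply_eq_zero (k : ℕ) (x : JordanModule α m) (j : Fin m)
    (hj : (j : ℕ) < k) : (shiftPoly α ^ k • x) j = 0 := by
  induction k generalizing j with
  | zero => omega
  | succ k ih =>
    rw [pow_succ', mul_smul, shiftPoly_smul]
    exact vecMul_shiftMatrix_eq_zero ih j hj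

lemma shiftPoly_pow_smul_apply (k : ℕ) (hk : k < m + 1) (x : JordanModule α (m + 1)) :
    (shiftPoly α ^ k • x) ⟨k, hk⟩ = x 0 := by
  induction k with
  | zero => rw [pow_zero, one_smul]; rfl
  | succ k ih =>
    rw [pow_succ', mul_smul, shiftPoly_smul]
    exact (vecMul_shiftMatrix_succ _ ⟨k, by omega⟩ _ rfl).trans (ih _)

lemma tSub_pow_smul_eq_zero {r : ℕ} (hr : m ≤ r) (x : JordanModule α m) : tSub α ^ r • x = 0 := by
  rw [tSub_eq_mul_shiftPoly, mul_pow, mul_smul]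
  have : shiftPoly α ^ r • x = 0 :=
    funext fun j => shiftPoly_pow_smul_apply_eq_zero r x j (j.2.trans_le hr)
  rw [this, smul_zero]

/-- The obstruction to lifting: `r` shifts move the first coordinate to position `r`, which is still
inside a row of length `m + 1`. -/
lemma apply_zero_eq_zero_of_tSub_pow_smul {r : ℕ} (hr : r ≤ m) {x : JordanModule α (m + 1)}
    (h : tSub α ^ r • x = 0) : x 0 = 0 := by
  have hu : IsUnit ((-LaurentPolynomial.T 1 : ℂ[T;T⁻¹]) ^ r) :=
    (LaurentPolynomial.isUnit_T (R := ℂ) 1).neg.pow r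
  rw [tSub_eq_mul_shiftPoly, mul_pow, mul_smul, hu.smul_eq_zero] at h
  have h1 := shiftPoly_pow_smul_apply (α := α) r (by omega) x
  rw [h] at h1
  exact h1.symm

/-- The first coordinate, as a homomorphism to `ℂ_α`. -/
def firstCoord (α : ℂˣ) (m : ℕ) : JordanModule α (m + 1) →ₗ[ℂ[T;T⁻¹]] LambdaC α where
  toFun x := x 0
  map_add' _ _ := rfl
  map_smul' f x := by
    change (f • x) 0 = f • (show LambdaC α from x 0)
    induction f using LaurentPolynomial.induction_on' with
    | add f g hf hg =>
      rw [add_smul, add_smul, ← hf, ← hg]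
      rfl
    | C_mul_T n a =>
      rw [mul_smul, jordanModule_C_smul, jordanModule_T_smul, lambdaC_smul, map_mul, evalAt_C,
        evalAt_T, mul_assoc]
      exact congrArg (fun z => a * ((α : ℂ) ^ n * z)) (vecMul_jordanBlock_zpow_zero (-n) x)

/-! ### Triangular representations and cocycles -/

variable {G : Type} [Group G] {p : Abelianization G ≃* Multiplicative ℤ}

/-- Only the upper right block carries a condition; the other blocks are multiplicative because
`|·|` is additive. -/
lemma rhoMatrix_mul_iff (V : Fin m → G → ℂ) (a b : G) :
    rhoMatrix p α V (a * b) = rhoMatrix p α V a * rhoMatrix p α V b ↔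
      (fun j => V j (a * b)) = (α : ℂ) ^ deg p a • (fun j => V j b)
        + (fun j => V j a) ᵥ* jordanBlock m ^ deg p b := by
  constructor
  · intro h
    ext j
    have := congrFun₂ h 0 j.succ
    simpa [rhoMatrix, mul_apply, Fin.sum_univ_succ, phi, vecMul, dotProduct] using this
  · intro h
    ext i j
    refine Fin.cases ?_ (fun i => ?_) i <;> refine Fin.cases ?_ (fun j => ?_) j
    · simp [rhoMatrix, mul_apply, Fin.sum_univ_succ, deg_mul, zpow_add₀ α.ne_zero]
    · have := congrFun h j
      simpa [rhoMatrix, mul_apply, Fin.sum_univ_succ, phi, vecMul, dotProduct] using this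
    · simp [rhoMatrix, mul_apply, Fin.sum_univ_succ]
    · simp [rhoMatrix, mul_apply, Fin.sum_univ_succ, phi, deg_mul, jordanBlock_zpow_add]

lemma rhoMatrix_one {V : Fin m → G → ℂ} (h : ∀ j, V j 1 = 0) : rhoMatrix p α V 1 = 1 := by
  ext i j
  refine Fin.cases ?_ (fun i => ?_) i <;> refine Fin.cases ?_ (fun j => ?_) j <;>
    simp [rhoMatrix, phi, deg_one, h, one_apply, (Fin.succ_ne_zero _).symm]

lemma blockTriangular_rhoMatrix (V : Fin m → G → ℂ) (γ : G) :
    (rhoMatrix p α V γ).BlockTriangular id := by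
  intro i j
  refine Fin.cases ?_ (fun i => ?_) i <;> refine Fin.cases ?_ (fun j => ?_) j <;> intro h
  · exact absurd h (lt_irrefl _)
  · exact absurd h (Fin.not_lt_zero _)
  · simp [rhoMatrix]
  · have := blockTriangular_jordanBlock_zpow m (deg p γ) (Fin.succ_lt_succ_iff.1 h : j < i)
    simpa [rhoMatrix, phi] using this

variable (α p) in
/-- The cochain with values in row vectors that corresponds to a tuple of cochains. -/
def rowCochain (V : Fin m → G → ℂ) (γ : G) : JordanModule α m :=
  ((fun j => V j γ) ᵥ* jordanBlock m ^ (-deg p γ) : Fin m → ℂ)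

lemma isCocycle_rowCochain_iff (V : Fin m → G → ℂ) :
    IsCocycle p (rowCochain α p V) ↔
      ∀ a b, rhoMatrix p α V (a * b) = rhoMatrix p α V a * rhoMatrix p α V b := by
  refine forall₂_congr fun a b => ?_
  rw [rhoMatrix_mul_iff]
  have hJ : ∀ x y : Fin m → ℂ, x = y ↔
      x ᵥ* jordanBlock m ^ (-deg p (a * b)) = y ᵥ* jordanBlock m ^ (-deg p (a * b)) := by
    refine fun x y => ⟨fun h => by rw [h], fun h => ?_⟩
    have := congrArg (· ᵥ* jordanBlock m ^ deg p (a * b)) h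
    simpa [vecMul_vecMul, ← jordanBlock_zpow_add] using this
  rw [hJ, jordanModule_T_smul]
  have h1 : ((α : ℂ) ^ deg p a • (fun j => V j b) + (fun j => V j a) ᵥ* jordanBlock m ^ deg p b)
      ᵥ* jordanBlock m ^ (-deg p (a * b)) = (fun j => V j a) ᵥ* jordanBlock m ^ (-deg p a)
        + (α : ℂ) ^ deg p a • (((fun j => V j b) ᵥ* jordanBlock m ^ (-deg p b))
          ᵥ* jordanBlock m ^ (-deg p a)) := by
    rw [add_vecMul, smul_vecMul, vecMul_vecMul, vecMul_vecMul, ← jordanBlock_zpow_add,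
      ← jordanBlock_zpow_add, add_comm, deg_mul]
    congr 4 <;> ring
  rw [h1]
  rfl

lemma IsRho.isCocycle {V : Fin m → G → ℂ} {ρ : G →* upperTriangularGroup (m + 1)}
    (h : IsRho p α V ρ) : IsCocycle p (rowCochain α p V) := by
  rw [isCocycle_rowCochain_iff]
  intro a b
  rw [← h, ← h, ← h, map_mul]
  rfl

lemma exists_isRho {V : Fin m → G → ℂ} (h : IsCocycle p (rowCochain α p V)) :
    ∃ ρ : G →* upperTriangularGroup (m + 1), IsRho p α V ρ := by
  have hV : ∀ j, V j 1 = 0 := by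
    have := h.map_one
    simp only [rowCochain, deg_one, neg_zero, zpow_zero, vecMul_one] at this
    exact congrFun this
  let f : G →* Matrix (Fin (m + 1)) (Fin (m + 1)) ℂ :=
    { toFun := rhoMatrix p α V
      map_one' := rhoMatrix_one hV
      map_mul' := (isCocycle_rowCochain_iff V).1 h }
  -- Invertibility is automatic: a monoid homomorphism on a group takes values in units.
  exact ⟨f.toHomUnits.codRestrict _ fun γ => blockTriangular_rhoMatrix V γ, fun γ => rfl⟩

lemma exists_rowCochain_eq (W : G → JordanModule α m) :
    ∃ V : Fin m → G → ℂ, rowCochain α p V = W := by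
  have h : ∀ (n : ℤ) (x : Fin m → ℂ), x ᵥ* jordanBlock m ^ n ᵥ* jordanBlock m ^ (-n) = x := by
    intro n x
    rw [vecMul_vecMul, ← jordanBlock_zpow_add, add_neg_cancel, zpow_zero, vecMul_one]
  exact ⟨fun j γ => (W γ ᵥ* jordanBlock m ^ deg p γ) j, funext fun γ => h (deg p γ) (W γ)⟩

lemma rowCochain_apply_zero (V : Fin (m + 1) → G → ℂ) (γ : G) :
    rowCochain α p V γ 0 = V 0 γ :=
  vecMul_jordanBlock_zpow_zero (-deg p γ) _

/-- The homomorphisms `ρ^V` are metabelian. -/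
lemma IsRho.eq_one_of_mem_derivedSeries {V : Fin m → G → ℂ}
    {ρ : G →* upperTriangularGroup (m + 1)} (h : IsRho p α V ρ) :
    ∀ γ ∈ derivedSeries G 2, ρ γ = 1 := by
  suffices derivedSeries G 2 ≤ ρ.ker from fun γ hγ => this hγ
  rw [derivedSeries_succ, derivedSeries_one, Subgroup.commutator_le]
  intro a ha b hb
  rw [MonoidHom.mem_ker, map_commutatorElement, commutatorElement_eq_one_iff_mul_comm,
    ← map_mul, ← map_mul]
  have hmul : ∀ c d, rhoMatrix p α V (c * d) = rhoMatrix p α V c * rhoMatrix p α V d :=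
    (isCocycle_rowCochain_iff V).1 h.isCocycle
  have ha0 := (deg_eq_zero_iff p a).2 ha
  have hb0 := (deg_eq_zero_iff p b).2 hb
  -- On elements of degree zero `V` is additive, so `V` agrees on `a * b` and `b * a`.
  have hV : (fun j => V j (a * b)) = fun j => V j (b * a) := by
    rw [(rhoMatrix_mul_iff V a b).1 (hmul a b), (rhoMatrix_mul_iff V b a).1 (hmul b a), ha0, hb0]
    simp [add_comm]
  refine Subtype.ext (Units.ext ?_)
  rw [h, h]
  ext i j
  refine Fin.cases ?_ (fun i => ?_) i <;> refine Fin.cases ?_ (fun j => ?_) j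
  · simp [rhoMatrix, deg_mul, add_comm]
  · simpa [rhoMatrix] using congrFun hV j
  · simp [rhoMatrix]
  · simp [rhoMatrix, phi, deg_mul, add_comm]

end Jordan

/-! ### Lifting cocycles through the first coordinate -/

section Main

variable {G : Type} [Group G] {p : Abelianization G ≃* Multiplicative ℤ} {α : ℂˣ}

lemma IsCocycle.comp {M N : Type} [AddCommGroup M] [Module ℂ[T;T⁻¹] M] [AddCommGroup N]
    [Module ℂ[T;T⁻¹] N] {W : G → M} (hW : IsCocycle p W) (f : M →ₗ[ℂ[T;T⁻¹]] N) :
    IsCocycle p fun γ => f (W γ) := fun a b => by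
  simp only [hW a b, map_add, map_smul]

lemma IsCocycle.add_coboundary {M : Type} [AddCommGroup M] [Module ℂ[T;T⁻¹] M] {W : G → M}
    (hW : IsCocycle p W) (z : M) :
    IsCocycle p fun γ => W γ + ((LaurentPolynomial.T (deg p γ) : ℂ[T;T⁻¹]) • z - z) := by
  intro a b
  simp only [hW a b, deg_mul, LaurentPolynomial.T_add, mul_smul, smul_add, smul_sub]
  abel

variable (p α) in
/-- The space of the cocycles with values in `ℂ_α` whose restriction to `G'` lifts to a
homomorphism from the Alexander module to the module of row vectors. -/
def liftableCocycles (m : ℕ) : Submodule ℂ (G → ℂ) where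
  carrier := {X | X ∈ Z1 p α ∧ ∃ w : AlexanderModule p →ₗ[ℂ[T;T⁻¹]] JordanModule α (m + 1),
    ∀ y : commutator G, firstCoord α m (w (derivedClass p y)) = X y}
  zero_mem' := ⟨zero_mem _, 0, fun y => by simp only [LinearMap.zero_apply, map_zero]; rfl⟩
  add_mem' := by
    rintro X Y ⟨hX, w, hw⟩ ⟨hY, w', hw'⟩
    refine ⟨add_mem hX hY, w + w', fun y => ?_⟩
    rw [LinearMap.add_apply, map_add, hw, hw']
    rfl
  smul_mem' := by
    rintro c X ⟨hX, w, hw⟩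
    refine ⟨Submodule.smul_mem _ c hX, (LaurentPolynomial.C c : ℂ[T;T⁻¹]) • w, fun y => ?_⟩
    rw [LinearMap.smul_apply, map_smul, lambdaC_smul, evalAt_C, hw]
    rfl

lemma B1_le_liftableCocycles (m : ℕ) : B1 p α ≤ liftableCocycles p α m := by
  refine fun X hX => ⟨B1_le_Z1 hX, 0, fun y => ?_⟩
  rw [eq_zero_of_mem_B1 hX, LinearMap.zero_apply, map_zero]
  rfl

lemma coe_liftableCocycles (hα : (α : ℂ) ≠ 1) (n : ℕ) :
    (liftableCocycles p α (n - 2) : Set (G → ℂ)) = CSet p α n := by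
  ext X
  constructor
  · rintro ⟨hX, w, hw⟩
    obtain ⟨W, hW, hWw⟩ := exists_isCocycle w
    let Y : G → ℂ := fun γ => firstCoord α (n - 2) (W γ)
    have hY : Y ∈ Z1 p α := mem_Z1_iff_isCocycle.2 (hW.comp (firstCoord α (n - 2)))
    have hB : X - Y ∈ B1 p α := by
      refine mem_B1_of_forall_commutator hα (sub_mem hX hY) fun y => ?_
      have : Y y = X y := by rw [← hw, ← hWw]
      rw [Pi.sub_apply, this, sub_self]
    obtain ⟨a, ha⟩ := (mem_B1_iff p α _).1 hB
    -- The coboundary of `z` corrects the first coordinate from `Y` to `X`. Only `z 0 = a` matters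
    -- for this; the other entries are arbitrary.
    let z : JordanModule α (n - 2 + 1) := fun _ => a
    obtain ⟨V, hV⟩ := exists_rowCochain_eq (α := α) (p := p)
      (fun γ => W γ + ((LaurentPolynomial.T (deg p γ) : ℂ[T;T⁻¹]) • z - z))
    have hV0 : V 0 = X := by
      ext γ
      rw [← rowCochain_apply_zero (α := α) (p := p) V γ, hV]
      change firstCoord α (n - 2) (W γ + ((LaurentPolynomial.T (deg p γ) : ℂ[T;T⁻¹]) • z - z)) = _
      rw [map_add, map_sub, map_smul, lambdaC_smul, evalAt_T]
      have h : Y γ + ((α : ℂ) ^ deg p γ * a - a) = X γ := by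
        rw [ha, Pi.sub_apply, add_sub_cancel]
      exact h
    obtain ⟨ρ, hρ⟩ := exists_isRho (V := V) (by rw [hV]; exact hW.add_coboundary z)
    refine ⟨hX, Fin.tail V, ρ, ?_⟩
    rwa [← hV0, Fin.cons_self_tail]
  · rintro ⟨hX, v, ρ, hρ⟩
    obtain ⟨w, hw⟩ := hρ.isCocycle.exists_linearMap
    refine ⟨hX, w, fun y => ?_⟩
    rw [hw]
    exact rowCochain_apply_zero (α := α) (p := p) _ _

/-! ### Cocycles dual to the summands of the primary part -/

variable {k : ℕ} {q : Fin k → ℕ}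
  (e : primaryPart p α ≃ₗ[ℂ[T;T⁻¹]] ⨁ i : Fin k, ℂ[T;T⁻¹] ⧸ Ideal.span {tSub α ^ q i})

/-- The generator of the `i`-th summand of the primary part. -/
def summandGen (i : Fin k) : primaryPart p α :=
  e.symm (DirectSum.lof ℂ[T;T⁻¹] (Fin k) (fun i => ℂ[T;T⁻¹] ⧸ Ideal.span {tSub α ^ q i}) i
    (Submodule.Quotient.mk 1))

lemma exists_eq_smul_summandGen (i : Fin k) (x : ℂ[T;T⁻¹] ⧸ Ideal.span {tSub α ^ q i}) :
    ∃ r : ℂ[T;T⁻¹], e.symm (DirectSum.lof ℂ[T;T⁻¹] (Fin k)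
      (fun i => ℂ[T;T⁻¹] ⧸ Ideal.span {tSub α ^ q i}) i x) = r • summandGen e i := by
  obtain ⟨r, rfl⟩ := Submodule.Quotient.mk_surjective _ x
  refine ⟨r, ?_⟩
  rw [summandGen, ← map_smul, ← map_smul, ← Submodule.Quotient.mk_smul, smul_eq_mul, mul_one]

lemma tSub_pow_smul_summandGen (i : Fin k) : tSub α ^ q i • summandGen e i = 0 := by
  rw [summandGen, ← map_smul, ← map_smul, ← Submodule.Quotient.mk_smul, smul_eq_mul, mul_one,
    (Submodule.Quotient.mk_eq_zero _).2 (Ideal.mem_span_singleton_self _), map_zero, map_zero]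

lemma linearMap_ext_summandGen {Δ : ℂ[T;T⁻¹]} (hΔ : IsAlexanderPolynomial p Δ)
    {u v : AlexanderModule p →ₗ[ℂ[T;T⁻¹]] LambdaC α}
    (h : ∀ i, u (summandGen e i) = v (summandGen e i)) : u = v := by
  refine linearMap_ext_primaryPart hΔ fun x => ?_
  rw [← e.symm_apply_apply x]
  induction e x using DirectSum.induction_on with
  | zero => simp
  | of i x =>
    obtain ⟨r, hr⟩ := exists_eq_smul_summandGen e i x
    change u (e.symm (DirectSum.lof ℂ[T;T⁻¹] (Fin k)
      (fun i => ℂ[T;T⁻¹] ⧸ Ideal.span {tSub α ^ q i}) i x)) = v (e.symm (DirectSum.lof ℂ[T;T⁻¹] (Fin k)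
      (fun i => ℂ[T;T⁻¹] ⧸ Ideal.span {tSub α ^ q i}) i x))
    rw [hr, Submodule.coe_smul, map_smul, map_smul, h]
  | add x y hx hy => rw [map_add, Submodule.coe_add, map_add, map_add, hx, hy]

/-- The hypothesis `hz` is the only relation of the `i`-th summand; the projection to the primary
part extends the resulting map to the whole module. -/
lemma exists_linearMap_summandGen {Δ : ℂ[T;T⁻¹]} (hΔ : IsAlexanderPolynomial p Δ) {M : Type}
    [AddCommGroup M] [Module ℂ[T;T⁻¹] M] (i : Fin k) (z : M) (hz : tSub α ^ q i • z = 0) :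
    ∃ w : AlexanderModule p →ₗ[ℂ[T;T⁻¹]] M, w (summandGen e i) = z ∧
      ∀ j, j ≠ i → w (summandGen e j) = 0 := by
  obtain ⟨P, hP⟩ := exists_projection hΔ α
  let f : (ℂ[T;T⁻¹] ⧸ Ideal.span {tSub α ^ q i}) →ₗ[ℂ[T;T⁻¹]] M :=
    Submodule.liftQSpanSingleton _ (LinearMap.toSpanSingleton ℂ[T;T⁻¹] M z) hz
  refine ⟨f ∘ₗ DirectSum.component _ _ (fun i => ℂ[T;T⁻¹] ⧸ Ideal.span {tSub α ^ q i}) i ∘ₗ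
    e.toLinearMap ∘ₗ P, ?_, fun j hj => ?_⟩
  · rw [LinearMap.comp_apply, LinearMap.comp_apply, LinearMap.comp_apply, hP, LinearEquiv.coe_coe,
      summandGen, LinearEquiv.apply_symm_apply, DirectSum.component.lof_self]
    exact one_smul _ z
  · rw [LinearMap.comp_apply, LinearMap.comp_apply, LinearMap.comp_apply, hP, LinearEquiv.coe_coe,
      summandGen, LinearEquiv.apply_symm_apply, DirectSum.component.of, dif_neg hj, map_zero]

variable {e}

lemma isDualCocycle_iff {i : Fin k} {U : G → ℂ} :
    IsDualCocycle p α e i U ↔ U ∈ Z1 p α ∧ ∃ u : AlexanderModule p →ₗ[ℂ[T;T⁻¹]] LambdaC α,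
      (∀ y : commutator G, u (derivedClass p y) = U y) ∧
      (∀ j, j ≠ i → u (summandGen e j) = 0) ∧ u (summandGen e i) ≠ 0 := by
  refine and_congr_right fun _ => exists_congr fun u => and_congr_right fun _ =>
    and_congr (forall₂_congr fun j _ => ⟨fun h => h _, fun h x => ?_⟩)
      ⟨fun ⟨x, hx⟩ h => hx ?_, fun h => ⟨_, h⟩⟩
  · obtain ⟨r, hr⟩ := exists_eq_smul_summandGen e j x
    rw [hr, Submodule.coe_smul, map_smul, h, smul_zero]
  · obtain ⟨r, hr⟩ := exists_eq_smul_summandGen e i x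
    rw [hr, Submodule.coe_smul, map_smul, h, smul_zero]

lemma exists_isDualCocycle {Δ : ℂ[T;T⁻¹]} (hΔ : IsAlexanderPolynomial p Δ) {i : Fin k}
    (hi : 1 ≤ q i) : ∃ U, IsDualCocycle p α e i U := by
  obtain ⟨u, hu, hu'⟩ := exists_linearMap_summandGen e hΔ i (show LambdaC α from (1 : ℂ))
    (lambdaC_smul_eq_zero (by rw [map_pow, evalAt_tSub, zero_pow (by omega)]) _)
  obtain ⟨U, hU, hUu⟩ := exists_isCocycle u
  refine ⟨U, isDualCocycle_iff.2 ⟨mem_Z1_iff_isCocycle.2 hU, u, fun y => (hUu y).symm, hu', ?_⟩⟩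
  rw [hu]
  exact one_ne_zero (α := ℂ)

lemma IsDualCocycle.mem_liftableCocycles {Δ : ℂ[T;T⁻¹]} (hΔ : IsAlexanderPolynomial p Δ)
    {i : Fin k} {U : G → ℂ} (hU : IsDualCocycle p α e i U) {m : ℕ} (hm : m + 1 ≤ q i) :
    U ∈ liftableCocycles p α m := by
  obtain ⟨hZ, u, hu, hu0, -⟩ := isDualCocycle_iff.1 hU
  -- For `m + 1 ≤ q i` every row is an admissible image of the generator; a constant row has the
  -- required first coordinate.
  obtain ⟨w, hw, hw0⟩ := exists_linearMap_summandGen e hΔ i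
    (show JordanModule α (m + 1) from fun _ => u (summandGen e i)) (tSub_pow_smul_eq_zero hm _)
  refine ⟨hZ, w, fun y => ?_⟩
  have h : firstCoord α m ∘ₗ w = u := by
    refine linearMap_ext_summandGen e hΔ fun j => ?_
    rw [LinearMap.comp_apply]
    by_cases hj : j = i
    · rw [hj, hw]
      rfl
    · rw [hw0 j hj, hu0 j hj, map_zero]
  rw [← hu, ← h, LinearMap.comp_apply]

/-- A linear combination of dual cocycles restricts to a homomorphism with known values on the
generators of the summands. -/
lemma exists_linearMap_sum {U : Fin k → G → ℂ} (hU : ∀ i, IsDualCocycle p α e i (U i)) :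
    ∃ d : Fin k → ℂ, (∀ i, d i ≠ 0) ∧ ∀ c : Fin k → ℂ,
      ∃ u : AlexanderModule p →ₗ[ℂ[T;T⁻¹]] LambdaC α,
        (∀ y : commutator G, u (derivedClass p y) = (∑ i, c i • U i) y) ∧
        ∀ i, u (summandGen e i) = c i * d i := by
  choose hZ u hu hu0 hd using fun i => isDualCocycle_iff.1 (hU i)
  refine ⟨fun i => u i (summandGen e i), hd, fun c =>
    ⟨∑ i, (LaurentPolynomial.C (c i) : ℂ[T;T⁻¹]) • u i, fun y => ?_, fun i => ?_⟩⟩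
  · rw [LinearMap.sum_apply, Finset.sum_apply]
    refine Finset.sum_congr (M := ℂ) rfl fun i _ => ?_
    rw [LinearMap.smul_apply, lambdaC_smul, evalAt_C, hu]
    rfl
  · rw [LinearMap.sum_apply, Finset.sum_eq_single i
      (fun j _ hj => by rw [LinearMap.smul_apply, hu0 j i hj.symm, smul_zero]) (by simp),
      LinearMap.smul_apply, lambdaC_smul, evalAt_C]

/-- Evaluation at the generators isolates each coefficient. Asking for vanishing on `G'` only yields
independence modulo coboundaries. -/
lemma eq_zero_of_sum_eq_zero {U : Fin k → G → ℂ} (hU : ∀ i, IsDualCocycle p α e i (U i))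
    {c : Fin k → ℂ} (hc : ∀ y : commutator G, (∑ i, c i • U i) y = 0) : c = 0 := by
  obtain ⟨d, hd, h⟩ := exists_linearMap_sum hU
  obtain ⟨u, hu, hu'⟩ := h c
  have h0 : u = 0 := linearMap_ext_derivedClass fun y => (hu y).trans (hc y)
  ext i
  have h1 : c i * d i = 0 := by
    rw [← hu', h0]
    rfl
  exact (mul_eq_zero.1 h1).resolve_right (hd i)

lemma linearIndependent_dualCocycles {U : Fin k → G → ℂ}
    (hU : ∀ i, IsDualCocycle p α e i (U i)) : LinearIndependent ℂ U :=
  Fintype.linearIndependent_iff.2 fun _ hc =>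
    congrFun (eq_zero_of_sum_eq_zero hU fun y => by rw [hc]; rfl)

lemma disjoint_B1_span {U : Fin k → G → ℂ} (hU : ∀ i, IsDualCocycle p α e i (U i)) :
    Disjoint (B1 p α) (Submodule.span ℂ (Set.range U)) := by
  rw [Submodule.disjoint_def]
  intro X hX hX'
  obtain ⟨c, rfl⟩ := (Submodule.mem_span_range_iff_exists_fun ℂ).1 hX'
  have hc : c = 0 := eq_zero_of_sum_eq_zero hU fun y => eq_zero_of_mem_B1 hX y
  simp [hc]

lemma liftableCocycles_eq (hα : (α : ℂ) ≠ 1) {Δ : ℂ[T;T⁻¹]} (hΔ : IsAlexanderPolynomial p Δ)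
    {U : Fin k → G → ℂ} (hU : ∀ i, IsDualCocycle p α e i (U i)) (m : ℕ) :
    liftableCocycles p α m = B1 p α ⊔ Submodule.span ℂ (U '' {i | m + 1 ≤ q i}) := by
  refine le_antisymm ?_ (sup_le (B1_le_liftableCocycles m) (Submodule.span_le.2 ?_))
  · rintro X ⟨hX, w, hw⟩
    obtain ⟨d, hd, h⟩ := exists_linearMap_sum hU
    let b : Fin k → ℂ := fun i => firstCoord α m (w (summandGen e i))
    have hb : ∀ i, ¬ m + 1 ≤ q i → b i = 0 := by
      intro i hi
      refine apply_zero_eq_zero_of_tSub_pow_smul (r := q i) (by omega)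
        (x := w (summandGen e i)) ?_
      rw [← map_smul, ← Submodule.coe_smul, tSub_pow_smul_summandGen, Submodule.coe_zero, map_zero]
    -- Dividing by `d i`, the value of `U i` on its own generator, makes the combination agree with
    -- the lift `w` on all generators.
    obtain ⟨u, hu, hu'⟩ := h fun i => b i / d i
    have huw : u = firstCoord α m ∘ₗ w :=
      linearMap_ext_summandGen e hΔ fun i => (hu' i).trans (div_mul_cancel₀ _ (hd i))
    have hsum : ∑ i, (b i / d i) • U i ∈ Submodule.span ℂ (U '' {i | m + 1 ≤ q i}) := by
      refine sum_mem fun i _ => ?_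
      by_cases hi : m + 1 ≤ q i
      · exact Submodule.smul_mem _ _ (Submodule.subset_span ⟨i, hi, rfl⟩)
      · rw [hb i hi, zero_div, zero_smul]
        exact zero_mem _
    rw [← sub_add_cancel X (∑ i, (b i / d i) • U i)]
    refine Submodule.add_mem_sup (mem_B1_of_forall_commutator hα (sub_mem hX ?_) fun y => ?_) hsum
    · exact sum_mem fun i _ => Submodule.smul_mem _ _ (hU i).1
    · rw [Pi.sub_apply, ← hu, huw, ← hw]
      exact sub_self (G := ℂ) _
  · rintro _ ⟨i, hi, rfl⟩
    exact (hU i).mem_liftableCocycles hΔ hi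

lemma finrank_liftableCocycles (hα : (α : ℂ) ≠ 1) {Δ : ℂ[T;T⁻¹]}
    (hΔ : IsAlexanderPolynomial p Δ) {U : Fin k → G → ℂ}
    (hU : ∀ i, IsDualCocycle p α e i (U i)) (m : ℕ) :
    Module.Finite ℂ (liftableCocycles p α m) ∧ Module.finrank ℂ (liftableCocycles p α m)
      = 1 + (Finset.univ.filter fun i => m + 1 ≤ q i).card := by
  have hfin : Module.Finite ℂ (Submodule.span ℂ (U '' {i | m + 1 ≤ q i})) :=
    FiniteDimensional.span_of_finite ℂ (Set.toFinite _)
  have hspan : Module.finrank ℂ (Submodule.span ℂ (U '' {i | m + 1 ≤ q i}))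
      = (Finset.univ.filter fun i => m + 1 ≤ q i).card := by
    rw [Set.image_eq_range, ← Fintype.card_subtype]
    exact finrank_span_eq_card ((linearIndependent_dualCocycles hU).comp _ Subtype.val_injective)
  have hdisj : Disjoint (B1 p α) (Submodule.span ℂ (U '' {i | m + 1 ≤ q i})) :=
    (disjoint_B1_span hU).mono_right (Submodule.span_mono (Set.image_subset_range _ _))
  have hsum := Submodule.finrank_sup_add_finrank_inf_eq (B1 p α)
    (Submodule.span ℂ (U '' {i | m + 1 ≤ q i}))
  rw [hdisj.eq_bot, finrank_bot, add_zero, finrank_B1 hα, hspan] at hsum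
  rw [liftableCocycles_eq hα hΔ hU]
  exact ⟨inferInstance, hsum⟩

end Main

end KnotGroupRep

end

theorem mainTheorem1
    (K : KnotGroupRep.Knot) (N : KnotGroupRep.Tube K.toFun) (x₀ : N.Exterior)
    (p : Abelianization (FundamentalGroup N.Exterior x₀) ≃* Multiplicative ℤ)
    (Δ : LaurentPolynomial ℂ) (hΔ : KnotGroupRep.IsAlexanderPolynomial p Δ)
    (α : ℂˣ) (hα : KnotGroupRep.evalAt α Δ = 0)
    (k : ℕ) (q : Fin k → ℕ) (hq : ∀ i, 1 ≤ q i)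
    (e : KnotGroupRep.primaryPart p α ≃ₗ[LaurentPolynomial ℂ]
      DirectSum (Fin k) fun i => LaurentPolynomial ℂ ⧸ Ideal.span {KnotGroupRep.tSub α ^ q i})
    (n : ℕ) (hn : 2 ≤ n) :
    (∃ U : Fin k → FundamentalGroup N.Exterior x₀ → ℂ,
      ∀ i, KnotGroupRep.IsDualCocycle p α e i (U i)) ∧
    ∃ C : Submodule ℂ (FundamentalGroup N.Exterior x₀ → ℂ),
      (C : Set (FundamentalGroup N.Exterior x₀ → ℂ)) = KnotGroupRep.CSet p α n ∧
      KnotGroupRep.B1 p α ≤ C ∧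
      (KnotGroupRep.B1 p α < C ↔ ∃ i, n - 1 ≤ q i) ∧
      (∀ U : Fin k → FundamentalGroup N.Exterior x₀ → ℂ,
        (∀ i, KnotGroupRep.IsDualCocycle p α e i (U i)) →
        C = KnotGroupRep.B1 p α ⊔ Submodule.span ℂ (U '' {i | n - 1 ≤ q i}) ∧
        Disjoint (KnotGroupRep.B1 p α) (Submodule.span ℂ (U '' {i | n - 1 ≤ q i}))) ∧
      Module.Finite ℂ C ∧
      Module.finrank ℂ C = 1 + (Finset.univ.filter fun i => n - 1 ≤ q i).card ∧
      ∀ (V : Fin (n - 1) → FundamentalGroup N.Exterior x₀ → ℂ)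
        (ρ : FundamentalGroup N.Exterior x₀ →* KnotGroupRep.upperTriangularGroup (n - 1 + 1)),
        KnotGroupRep.IsRho p α V ρ →
        ∀ γ ∈ derivedSeries (FundamentalGroup N.Exterior x₀) 2, ρ γ = 1 := by
  have hα1 := KnotGroupRep.root_ne_one hΔ hα
  choose U hU using fun i => KnotGroupRep.exists_isDualCocycle (e := e) hΔ (hq i)
  have hm : n - 1 = n - 2 + 1 := by omega
  obtain ⟨hfin, hrank⟩ := KnotGroupRep.finrank_liftableCocycles hα1 hΔ hU (n - 2)
  have hle := KnotGroupRep.B1_le_liftableCocycles (p := p) (α := α) (n - 2)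
  rw [← hm] at hrank
  refine ⟨⟨U, hU⟩, KnotGroupRep.liftableCocycles p α (n - 2),
    KnotGroupRep.coe_liftableCocycles hα1 n, hle, ⟨fun hlt => ?_, fun ⟨i, hi⟩ => ?_⟩,
    fun U' hU' => ⟨?_, ?_⟩, hfin, hrank, fun V ρ hρ => hρ.eq_one_of_mem_derivedSeries⟩
  -- The coboundaries have dimension `1`, so strict inclusion means that the set counted in the
  -- dimension formula is nonempty.
  · have h := Submodule.finrank_lt_finrank_of_lt hlt
    rw [KnotGroupRep.finrank_B1 hα1, hrank, lt_add_iff_pos_right, Finset.card_pos] at h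
    obtain ⟨i, hi⟩ := h
    exact ⟨i, (Finset.mem_filter.1 hi).2⟩
  · refine lt_of_le_of_ne hle fun h => ?_
    rw [← h, KnotGroupRep.finrank_B1 hα1, left_eq_add, Finset.card_eq_zero] at hrank
    exact Finset.notMem_empty i (hrank ▸ Finset.mem_filter.2 ⟨Finset.mem_univ i, hi⟩)
  · rw [hm]
    exact KnotGroupRep.liftableCocycles_eq hα1 hΔ hU' (n - 2)
  · exact (KnotGroupRep.disjoint_B1_span hU').mono_right
      (Submodule.span_mono (Set.image_subset_range _ _))
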